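/- For $k,m,z\in\mathbb C$ with $z\ne 0$ and $|\arg z|<\pi$, let $W_{k,m}(z)$ denote the principal branch of the Whittaker function, that is, the solution of $$w''(z)+\Bigl(-\frac14+\frac kz+\frac{\frac14-m^2}{z^2}\Bigr)w(z)=0$$ with $W_{k,m}(z)\sim e^{-z/2}z^k$ as $z\to\infty$ in every sector $|\arg z|\le\pi-\delta$, $\delta>0$. All powers have their principal values. If $\Re(\frac12+m-k)>0$, it is given by $$W_{k,m}(z)=\frac{e^{-z/2}z^k}{\Gamma(\frac12+m-k)}\int_0^\infty e^{-s}s^{m-k-\frac12}\Bigl(1+\frac sz\Bigr)^{m+k-\frac12}\,ds,$$ and $W_{k,m}=W_{k,-m}$. **Theorem.** Let $x\in\mathbb C$, $x\neq0$, $|\arg x|\le\frac12\pi$, let $m\in\mathbb R$, let $k\in\mathbb C$ with $\Re k<\frac12$, and let $\tau\ge1$. Then $W_{k,m}(x)\ne0$ and $$\left|\frac{W_{k,m}(\tau x)}{W_{k,m}(x)}\right|^2\le\tau\,e^{(1-\tau)\Re x}.$$ In particular, for fixed $x$ and $\tau$, the bound on the right-hand side depends neither on $k$ nor on $m$. -/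

import Mathlib

open MeasureTheory

/-- The classical integral of Whittaker and Watson for the Whittaker function `W_{k,m}(z)`:
`e^{-z/2} z^k / Γ(1/2 + m - k) * ∫_0^∞ e^{-s} s^{m-k-1/2} (1 + s/z)^{m+k-1/2} ds`,
with principal values of all powers. It represents `W_{k,m}(z)` for `z ≠ 0`, `|arg z| < π`
and `Re (1/2 + m - k) > 0`; there the integral converges absolutely and `1 + s/z` is never on
the cut `(-∞, 0]`. -/
noncomputable def whittakerIntegral (k m z : ℂ) : ℂ :=
  Complex.exp (-z / 2) * z ^ k / Complex.Gamma (1 / 2 + m - k) *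
    ∫ s in Set.Ioi (0 : ℝ),
      Complex.exp (-(s : ℂ)) * (s : ℂ) ^ (m - k - 1 / 2) * (1 + (s : ℂ) / z) ^ (m + k - 1 / 2)

/-- The (principal branch of the) Whittaker function `W_{k,m}(z)`, for `z ≠ 0`, `|arg z| < π`:
the solution of `w'' + (-1/4 + k/z + (1/4 - m²)/z²) w = 0` that is asymptotic to
`e^{-z/2} z^k` as `z → ∞`. It is given by the classical integral when
`Re (1/2 + m - k) > 0`, and otherwise by the same integral for `W_{k,-m} = W_{k,m}`, which is
available when `Re (1/2 - m - k) > 0`. One of the two cases applies whenever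
`Re k < 1/2 + |Re m|`, in particular whenever `Re k < 1/2`; the definition is only meant to be
used in this range of parameters. -/
noncomputable def whittakerW (k m z : ℂ) : ℂ :=
  if 0 < (1 / 2 + m - k).re then whittakerIntegral k m z else whittakerIntegral k (-m) z

/-! Put `κ = 1/2 - k`, so `Re κ > 0`, and strip the elementary factors: `W = e^{-z/2} z^{1/2} A /
Γ(m + κ)`. The factor `|e^{-z/2} z^{1/2}|²` alone produces `τ e^{(1-τ) Re x}`, so it remains to see
that `A` has no zeros and that `|A|` decreases along rays from the origin.

With `G = z A'`, Whittaker's equation becomes `z G' = z G + (m² + κ z) A`. Radially, `|A|²` has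
derivative of the sign of `Re (conj A * G)`. To find that sign, move horizontally instead
(`re_conj_mul_nonpos_of_system`): on `w = z + t` the function `e^{-t} Re (conj A * G)` has
derivative `e^{-t} (|G|² Re w⁻¹ + (m² Re w⁻¹ + Re κ) |A|²) ≥ 0` and tends to 0, so it is
nonpositive. A zero of `A` would force `A = 0` on the whole horizontal ray, whereas the Euler
integral tends to `Γ(m + κ) ≠ 0` there. -/

/-! ### Bounds and limit of the Euler integral -/

theorem exists_rpow_le_mul_exp {c ε : ℝ} (hc : 0 < c) (hε : 0 < ε) (q : ℝ) :
    ∃ K : ℝ, 0 < K ∧ ∀ u : ℝ, c ≤ u → u ^ q ≤ K * Real.exp (ε * u) := by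
  rcases le_or_gt q 0 with hq | hq
  · refine ⟨c ^ q, Real.rpow_pos_of_pos hc q, fun u hu => ?_⟩
    have h1 : u ^ q ≤ c ^ q := Real.rpow_le_rpow_of_nonpos hc hu hq
    have h2 : 1 ≤ Real.exp (ε * u) := Real.one_le_exp (by nlinarith)
    nlinarith [Real.rpow_pos_of_pos hc q]
  -- The constant comes from raising `y ≤ e^y` at `y = ε u / q` to the power `q`.
  · refine ⟨(q / ε) ^ q, by positivity, fun u hu => ?_⟩
    have hu0 : 0 < u := hc.trans_le hu
    have h1 : ε * u / q ≤ Real.exp (ε * u / q) := by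
      linarith [Real.add_one_le_exp (ε * u / q)]
    calc u ^ q = (q / ε * (ε * u / q)) ^ q := by congr 1; field_simp
      _ = (q / ε) ^ q * (ε * u / q) ^ q := by
          rw [Real.mul_rpow (by positivity) (by positivity)]
      _ ≤ (q / ε) ^ q * (Real.exp (ε * u / q)) ^ q := by gcongr
      _ = _ := by
          rw [← Real.exp_mul]
          congr 2
          field_simp

theorem one_add_div_mem_slitPlane {w : ℂ} (hw : w ∈ Complex.slitPlane) {s : ℝ} (hs : 0 ≤ s) :
    1 + (s : ℂ) / w ∈ Complex.slitPlane := by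
  have hw0 : w ≠ 0 := Complex.slitPlane_ne_zero hw
  have hn : 0 < Complex.normSq w := Complex.normSq_pos.2 hw0
  rw [Complex.mem_slitPlane_iff] at hw ⊢
  have hre : (1 + (s : ℂ) / w).re = 1 + s * w.re / Complex.normSq w := by
    simp [Complex.div_re]
  have him : (1 + (s : ℂ) / w).im = -(s * w.im / Complex.normSq w) := by
    simp [Complex.div_im]
  rw [hre, him]
  by_cases hi : w.im = 0
  · left
    have : 0 < w.re := by tauto
    positivity
  · rcases hs.eq_or_lt with rfl | hs
    · left; simp
    · right
      simp [hi, hs.ne', hw0]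

/-- Half of the decay of `e^{-s}` is spent on the power, uniformly in `w`. The lower bound `1 / 3`
matters when `Re q < 0`; its value is the one available on the ball used for differentiation in `z`.
-/
theorem exists_norm_one_add_div_cpow_le {δ : ℝ} (hδ : 0 < δ) (q : ℂ) :
    ∃ K : ℝ, 0 < K ∧ ∀ (w : ℂ) (s : ℝ), δ ≤ ‖w‖ → 0 ≤ s → 1 / 3 ≤ ‖1 + (s : ℂ) / w‖ →
      ‖(1 + (s : ℂ) / w) ^ q‖ ≤ K * Real.exp (s / 2) := by
  obtain ⟨K, hK, h⟩ := exists_rpow_le_mul_exp (c := 1 / 3) (ε := δ / 2) (by norm_num)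
    (by positivity) q.re
  refine ⟨Real.exp (Real.pi * |q.im|) * K * Real.exp (δ / 2), by positivity,
    fun w s hw hs hl => ?_⟩
  have h1 := Complex.norm_cpow_le (1 + (s : ℂ) / w) q
  have h2 := h _ hl
  have h3 : ‖1 + (s : ℂ) / w‖ ≤ 1 + s / δ := by
    refine (norm_add_le _ _).trans ?_
    rw [norm_one, norm_div, Complex.norm_real, Real.norm_of_nonneg hs]
    gcongr
  have h4 : (Real.exp (Complex.arg (1 + (s : ℂ) / w) * q.im))⁻¹ ≤
      Real.exp (Real.pi * |q.im|) := by
    rw [← Real.exp_neg]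
    apply Real.exp_le_exp.2
    calc -(Complex.arg (1 + (s : ℂ) / w) * q.im) ≤ |Complex.arg (1 + (s : ℂ) / w) * q.im| :=
          neg_le_abs _
      _ = |Complex.arg (1 + (s : ℂ) / w)| * |q.im| := abs_mul _ _
      _ ≤ _ := by gcongr; exact Complex.abs_arg_le_pi _
  have h5 : Real.exp (δ / 2 * ‖1 + (s : ℂ) / w‖) ≤ Real.exp (δ / 2) * Real.exp (s / 2) := by
    rw [← Real.exp_add]
    apply Real.exp_le_exp.2
    calc δ / 2 * ‖1 + (s : ℂ) / w‖ ≤ δ / 2 * (1 + s / δ) := by gcongr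
      _ = _ := by field_simp
  calc ‖(1 + (s : ℂ) / w) ^ q‖
      ≤ ‖1 + (s : ℂ) / w‖ ^ q.re * (Real.exp (Complex.arg (1 + (s : ℂ) / w) * q.im))⁻¹ := by
        rw [← div_eq_mul_inv]; exact h1
    _ ≤ (K * (Real.exp (δ / 2) * Real.exp (s / 2))) * Real.exp (Real.pi * |q.im|) := by
        gcongr
        exact h2.trans (by gcongr)
    _ = _ := by ring

/-- The integral `∫_0^∞ e^{-s} s^b (1 + s/z)^q ds`. -/
noncomputable def eulerKernelIntegral (b q z : ℂ) : ℂ :=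
  ∫ s in Set.Ioi (0 : ℝ), Complex.exp (-(s : ℂ)) * (s : ℂ) ^ b * (1 + (s : ℂ) / z) ^ q

theorem integrableOn_exp_neg_half_mul_rpow {β : ℝ} (hβ : -1 < β) :
    IntegrableOn (fun s : ℝ => Real.exp (-(s / 2)) * s ^ β) (Set.Ioi 0) := by
  have h := integrableOn_rpow_mul_exp_neg_mul_rpow (p := 1) hβ one_pos (b := 1 / 2) (by norm_num)
  refine h.congr_fun (fun s hs => ?_) measurableSet_Ioi
  simp only [Real.rpow_one]
  rw [mul_comm]
  congr 2
  ring

theorem norm_exp_neg_mul_cpow_mul_le {b v : ℂ} {s K : ℝ} (hs : 0 < s)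
    (hv : ‖v‖ ≤ K * Real.exp (s / 2)) :
    ‖Complex.exp (-(s : ℂ)) * (s : ℂ) ^ b * v‖ ≤ K * (Real.exp (-(s / 2)) * s ^ b.re) := by
  rw [norm_mul, norm_mul, Complex.norm_cpow_eq_rpow_re_of_pos hs, Complex.norm_exp]
  calc _ ≤ Real.exp (-(s : ℂ)).re * s ^ b.re * (K * Real.exp (s / 2)) := by gcongr
    _ = K * ((Real.exp (-s) * Real.exp (s / 2)) * s ^ b.re) := by simp; ring
    _ = _ := by rw [← Real.exp_add]; congr 3; ring

theorem aestronglyMeasurable_eulerKernel (b q : ℂ) {w : ℂ} (hw : w ∈ Complex.slitPlane) :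
    AEStronglyMeasurable
      (fun s : ℝ => Complex.exp (-(s : ℂ)) * (s : ℂ) ^ b * (1 + (s : ℂ) / w) ^ q)
      (volume.restrict (Set.Ioi 0)) := by
  refine ContinuousOn.aestronglyMeasurable (fun s hs => ?_) measurableSet_Ioi
  have hs : (0 : ℝ) < s := hs
  have h1 := one_add_div_mem_slitPlane hw hs.le
  have h2 : (s : ℂ) ∈ Complex.slitPlane := by simp [hs]
  refine ContinuousAt.continuousWithinAt ?_
  refine ContinuousAt.mul (ContinuousAt.mul (by fun_prop) ?_) ?_
  · exact ContinuousAt.cpow (by fun_prop) continuousAt_const h2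
  · exact ContinuousAt.cpow (by fun_prop) continuousAt_const h1

theorem one_le_norm_one_add_div {z : ℂ} (hz : 0 ≤ z.re) {s : ℝ} (hs : 0 ≤ s) :
    1 ≤ ‖1 + (s : ℂ) / z‖ := by
  refine le_trans ?_ (Complex.re_le_norm _)
  have : (1 + (s : ℂ) / z).re = 1 + s * z.re / Complex.normSq z := by
    simp [Complex.div_re]
  rw [this]
  have := Complex.normSq_nonneg z
  have : 0 ≤ s * z.re / Complex.normSq z := by positivity
  linarith

theorem norm_le_norm_add_ofReal {z : ℂ} (hz : 0 ≤ z.re) {t : ℝ} (ht : 0 ≤ t) :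
    ‖z‖ ≤ ‖z + t‖ := by
  rw [← sq_le_sq₀ (norm_nonneg _) (norm_nonneg _), ← Complex.normSq_eq_norm_sq,
    ← Complex.normSq_eq_norm_sq, Complex.normSq_apply, Complex.normSq_apply]
  simp
  nlinarith [mul_nonneg hz ht]

theorem mem_slitPlane_of_re_nonneg {z : ℂ} (hz : 0 ≤ z.re) (hz0 : z ≠ 0) :
    z ∈ Complex.slitPlane := by
  rw [Complex.mem_slitPlane_iff]
  by_contra! h
  exact hz0 (Complex.ext (le_antisymm h.1 hz) h.2)

theorem integrableOn_eulerKernel {b : ℂ} (hb : -1 < b.re) (q : ℂ) {z : ℂ} (hz : 0 ≤ z.re)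
    (hz0 : z ≠ 0) :
    IntegrableOn (fun s : ℝ => Complex.exp (-(s : ℂ)) * (s : ℂ) ^ b * (1 + (s : ℂ) / z) ^ q)
      (Set.Ioi 0) := by
  obtain ⟨K, hK, h⟩ := exists_norm_one_add_div_cpow_le (norm_pos_iff.2 hz0) q
  refine Integrable.mono' ((integrableOn_exp_neg_half_mul_rpow hb).const_mul K)
    (aestronglyMeasurable_eulerKernel b q (mem_slitPlane_of_re_nonneg hz hz0)) ?_
  refine (ae_restrict_iff' measurableSet_Ioi).2 (Filter.Eventually.of_forall fun s hs => ?_)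
  have hs : (0 : ℝ) < s := hs
  exact norm_exp_neg_mul_cpow_mul_le hs
    (h z s le_rfl hs.le (le_trans (by norm_num) (one_le_norm_one_add_div hz hs.le)))

theorem exists_norm_eulerKernelIntegral_le {b : ℂ} (hb : -1 < b.re) (q : ℂ) {δ : ℝ}
    (hδ : 0 < δ) :
    ∃ C : ℝ, ∀ z : ℂ, 0 ≤ z.re → δ ≤ ‖z‖ → ‖eulerKernelIntegral b q z‖ ≤ C := by
  obtain ⟨K, hK, h⟩ := exists_norm_one_add_div_cpow_le hδ q
  refine ⟨_, fun z hz hzδ => norm_integral_le_of_norm_le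
    ((integrableOn_exp_neg_half_mul_rpow hb).const_mul K) ?_⟩
  refine (ae_restrict_iff' measurableSet_Ioi).2 (Filter.Eventually.of_forall fun s hs => ?_)
  have hs : (0 : ℝ) < s := hs
  exact norm_exp_neg_mul_cpow_mul_le hs
    (h z s hzδ hs.le (le_trans (by norm_num) (one_le_norm_one_add_div hz hs.le)))

open Filter Topology in
theorem tendsto_eulerKernelIntegral {b : ℂ} (hb : -1 < b.re) (q : ℂ) {z : ℂ} (hz : 0 ≤ z.re)
    (hz0 : z ≠ 0) :
    Tendsto (fun t : ℝ => eulerKernelIntegral b q (z + t)) atTop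
      (𝓝 (Complex.Gamma (b + 1))) := by
  rw [Complex.Gamma_eq_integral (by simp; linarith), Complex.GammaIntegral]
  obtain ⟨K, hK, h⟩ := exists_norm_one_add_div_cpow_le (norm_pos_iff.2 hz0) q
  have hle : ∀ t : ℝ, 0 ≤ t → ‖z‖ ≤ ‖z + t‖ := fun t ht => norm_le_norm_add_ofReal hz ht
  refine tendsto_integral_filter_of_dominated_convergence
    (fun s => K * (Real.exp (-(s / 2)) * s ^ b.re)) ?_ ?_
    ((integrableOn_exp_neg_half_mul_rpow hb).const_mul K) ?_
  · filter_upwards [eventually_ge_atTop 0] with t ht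
    apply aestronglyMeasurable_eulerKernel
    apply mem_slitPlane_of_re_nonneg
    · simp; positivity
    · exact norm_pos_iff.1 ((norm_pos_iff.2 hz0).trans_le (hle t ht))
  · filter_upwards [eventually_ge_atTop 0] with t ht
    refine (ae_restrict_iff' measurableSet_Ioi).2 (Filter.Eventually.of_forall fun s hs => ?_)
    have hs : (0 : ℝ) < s := hs
    refine norm_exp_neg_mul_cpow_mul_le hs (h _ s (hle t ht) hs.le
      (le_trans (by norm_num) (one_le_norm_one_add_div ?_ hs.le)))
    simp; positivity
  · refine (ae_restrict_iff' measurableSet_Ioi).2 (Filter.Eventually.of_forall fun s hs => ?_)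
    have h1 : Tendsto (fun t : ℝ => (s : ℂ) / (z + t)) atTop (𝓝 0) := by
      refine squeeze_zero_norm' (a := fun t => s / t) ?_
        (tendsto_const_nhds.div_atTop tendsto_id)
      filter_upwards [eventually_gt_atTop 0] with t ht
      have hs : (0 : ℝ) < s := hs
      rw [norm_div, Complex.norm_real, Real.norm_of_nonneg hs.le]
      gcongr
      refine le_trans ?_ (Complex.re_le_norm _)
      simpa using hz
    have h2 : Tendsto (fun t : ℝ => (1 + (s : ℂ) / (z + t)) ^ q) atTop (𝓝 ((1 + 0) ^ q)) := by
      refine (tendsto_const_nhds.add h1).cpow tendsto_const_nhds ?_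
      simp
    have h3 := h2.const_mul (Complex.exp (-(s : ℂ)) * (s : ℂ) ^ b)
    simpa using h3

/-! ### Derivative of the Euler integral and integration by parts -/

theorem cpow_add_one_of_ne_zero {x : ℂ} (y : ℂ) (hx : x ≠ 0) : x ^ (y + 1) = x ^ y * x := by
  rw [Complex.cpow_add _ _ hx, Complex.cpow_one]

/-- The ball may leave the right half plane, so `w + s` is compared with `z + s`; `1/3 = (1 - 1/2) /
(1 + 1/2)`. -/
theorem norm_one_add_div_ge_of_mem_ball {z w : ℂ} (hz : 0 ≤ z.re)
    (hw : w ∈ Metric.ball z (‖z‖ / 2)) {s : ℝ} (hs : 0 ≤ s) :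
    1 / 3 ≤ ‖1 + (s : ℂ) / w‖ := by
  rw [Metric.mem_ball, dist_eq_norm] at hw
  have hzn : 0 < ‖z‖ := by
    by_contra! h
    linarith [norm_nonneg (w - z)]
  have h1 : ‖z‖ ≤ ‖z + s‖ := norm_le_norm_add_ofReal hz hs
  have h2 : ‖z + s‖ ≤ ‖w + s‖ + ‖w - z‖ := by
    calc ‖z + s‖ = ‖(w + s) - (w - z)‖ := by congr 1; ring
      _ ≤ _ := norm_sub_le _ _
  have h3 : ‖w‖ ≤ ‖z‖ + ‖w - z‖ := by
    calc ‖w‖ = ‖z + (w - z)‖ := by congr 1; ring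
      _ ≤ _ := norm_add_le _ _
  have h4 : ‖z‖ ≤ ‖w‖ + ‖w - z‖ := by
    calc ‖z‖ = ‖w - (w - z)‖ := by congr 1; ring
      _ ≤ _ := norm_sub_le _ _
  have hw0 : w ≠ 0 := norm_pos_iff.1 (by linarith)
  have : 1 + (s : ℂ) / w = (w + s) / w := by field_simp
  rw [this, norm_div, le_div_iff₀ (norm_pos_iff.2 hw0)]
  linarith

/-- A point of the cut is at distance at least `‖z‖` from `z`, because `Re z ≥ 0`. -/
theorem mem_slitPlane_of_mem_ball {z w : ℂ} (hz : 0 ≤ z.re)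
    (hw : w ∈ Metric.ball z (‖z‖ / 2)) : w ∈ Complex.slitPlane := by
  rw [Complex.mem_slitPlane_iff]
  by_contra! h
  rw [Metric.mem_ball, dist_eq_norm, ← sq_lt_sq₀ (norm_nonneg _) (by positivity), div_pow,
    ← Complex.normSq_eq_norm_sq, ← Complex.normSq_eq_norm_sq, Complex.normSq_apply,
    Complex.normSq_apply] at hw
  simp [h.2] at hw
  nlinarith [mul_nonneg hz (neg_nonneg.2 h.1), mul_self_nonneg z.re,
    mul_self_nonneg z.im, mul_self_nonneg w.re]

theorem hasDerivAt_eulerKernelIntegral_shift {b : ℂ} (hb : -1 < b.re) (q : ℂ) {z : ℂ}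
    (hz : 0 ≤ z.re) (hz0 : z ≠ 0) :
    HasDerivAt (eulerKernelIntegral b q) (-(q / z ^ 2) * eulerKernelIntegral (b + 1) (q - 1) z)
      z := by
  have hzn : 0 < ‖z‖ := norm_pos_iff.2 hz0
  obtain ⟨K, hK, h⟩ := exists_norm_one_add_div_cpow_le (half_pos hzn) (q - 1)
  have hball : ∀ w ∈ Metric.ball z (‖z‖ / 2), ‖z‖ / 2 ≤ ‖w‖ := fun w hw => by
    rw [Metric.mem_ball, dist_eq_norm] at hw
    have h4 : ‖z‖ ≤ ‖w‖ + ‖w - z‖ := by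
      calc ‖z‖ = ‖w - (w - z)‖ := by congr 1; ring
        _ ≤ _ := norm_sub_le _ _
    linarith
  have key := hasDerivAt_integral_of_dominated_loc_of_deriv_le
    (μ := volume.restrict (Set.Ioi (0 : ℝ)))
    (F := fun w s => Complex.exp (-(s : ℂ)) * (s : ℂ) ^ b * (1 + (s : ℂ) / w) ^ q)
    (F' := fun w s => -(q / w ^ 2) *
      (Complex.exp (-(s : ℂ)) * (s : ℂ) ^ (b + 1) * (1 + (s : ℂ) / w) ^ (q - 1)))
    (x₀ := z) (s := Metric.ball z (‖z‖ / 2))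
    (bound := fun s => ‖q‖ / (‖z‖ / 2) ^ 2 *
      (K * (Real.exp (-(s / 2)) * s ^ (b + 1).re)))
    (Metric.ball_mem_nhds z (half_pos hzn))
    (by
      filter_upwards [Metric.ball_mem_nhds z (half_pos hzn)] with w hw
      exact aestronglyMeasurable_eulerKernel _ _ (mem_slitPlane_of_mem_ball hz hw))
    (integrableOn_eulerKernel hb q hz hz0)
    ((aestronglyMeasurable_eulerKernel _ _ (mem_slitPlane_of_re_nonneg hz hz0)).const_mul _)
    (by
      refine (ae_restrict_iff' measurableSet_Ioi).2 (Filter.Eventually.of_forall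
        fun s hs w hw => ?_)
      have hs : (0 : ℝ) < s := hs
      rw [norm_mul, norm_neg, norm_div, norm_pow]
      have := hball w hw
      gcongr
      exact norm_exp_neg_mul_cpow_mul_le hs
        (h w s this hs.le (norm_one_add_div_ge_of_mem_ball hz hw hs.le)))
    (((integrableOn_exp_neg_half_mul_rpow (by simp; linarith)).const_mul K).const_mul _)
    (by
      refine (ae_restrict_iff' measurableSet_Ioi).2 (Filter.Eventually.of_forall
        fun s hs w hw => ?_)
      have hs : (0 : ℝ) < s := hs
      have hws := mem_slitPlane_of_mem_ball hz hw
      have hw0 : w ≠ 0 := Complex.slitPlane_ne_zero hws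
      have h1 : HasDerivAt (fun w : ℂ => 1 + (s : ℂ) / w) (-(s : ℂ) / w ^ 2) w := by
        simpa using ((hasDerivAt_const w (s : ℂ)).div (hasDerivAt_id w) hw0).const_add 1
      have h2 := (h1.cpow_const (c := q) (one_add_div_mem_slitPlane hws hs.le)).const_mul
        (Complex.exp (-(s : ℂ)) * (s : ℂ) ^ b)
      refine h2.congr_deriv ?_
      rw [Complex.cpow_add _ _ (by exact_mod_cast hs.ne'), Complex.cpow_one]
      ring)
  have := key.2
  rw [integral_const_mul] at this
  exact this

/-- The derivative of the integral, expressed by integrals with the same power of `s`. -/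
theorem hasDerivAt_eulerKernelIntegral {b : ℂ} (hb : -1 < b.re) (q : ℂ) {z : ℂ}
    (hz : 0 ≤ z.re) (hz0 : z ≠ 0) :
    HasDerivAt (eulerKernelIntegral b q)
      (-(q / z) * (eulerKernelIntegral b q z - eulerKernelIntegral b (q - 1) z)) z := by
  refine (hasDerivAt_eulerKernelIntegral_shift hb q hz hz0).congr_deriv ?_
  have : eulerKernelIntegral b q z - eulerKernelIntegral b (q - 1) z =
      z⁻¹ * eulerKernelIntegral (b + 1) (q - 1) z := by
    unfold eulerKernelIntegral
    rw [← integral_sub (integrableOn_eulerKernel hb q hz hz0)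
      (integrableOn_eulerKernel hb (q - 1) hz hz0), ← integral_const_mul]
    refine setIntegral_congr_fun measurableSet_Ioi fun s hs => ?_
    have hs : (0 : ℝ) < s := hs
    have h1 := Complex.slitPlane_ne_zero
      (one_add_div_mem_slitPlane (mem_slitPlane_of_re_nonneg hz hz0) hs.le)
    have h2 : (1 + (s : ℂ) / z) ^ q = (1 + (s : ℂ) / z) ^ (q - 1) * (1 + (s : ℂ) / z) := by
      rw [← cpow_add_one_of_ne_zero _ h1, sub_add_cancel]
    rw [h2, Complex.cpow_add _ _ (by exact_mod_cast hs.ne'), Complex.cpow_one]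
    field_simp
    ring
  rw [this]
  field_simp

-- Integrate the derivative of `e^{-s} s^{b+1} (1 + s/z)^q`; the boundary terms vanish. Writing `s =
-- z ((1 + s/z) - 1)` trades extra powers of `s` for shifts of `q`.
open Filter Topology in
theorem eulerKernelIntegral_integration_by_parts {b : ℂ} (hb : -1 < b.re) (q : ℂ) {z : ℂ}
    (hz : 0 ≤ z.re) (hz0 : z ≠ 0) :
    (b + 1 + z) * eulerKernelIntegral b q z - z * eulerKernelIntegral b (q + 1) z =
      -q * (eulerKernelIntegral b q z - eulerKernelIntegral b (q - 1) z) := by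
  have hzn : 0 < ‖z‖ := norm_pos_iff.2 hz0
  have hsl := mem_slitPlane_of_re_nonneg hz hz0
  have hi := integrableOn_eulerKernel hb q hz hz0
  have hi1 := integrableOn_eulerKernel hb (q + 1) hz hz0
  have hi2 := integrableOn_eulerKernel hb (q - 1) hz hz0
  have hint := (((hi.const_mul (b + 1 + z)).sub (hi1.const_mul z)).add
    ((hi.sub hi2).const_mul q))
  have hb1 : b + 1 ≠ 0 := fun h => by
    have := congrArg Complex.re h
    simp at this
    linarith
  have key := integral_Ioi_of_hasDerivAt_of_tendsto (a := 0) (m := 0)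
    (f := fun s : ℝ => Complex.exp (-(s : ℂ)) * (s : ℂ) ^ (b + 1) * (1 + (s : ℂ) / z) ^ q)
    ?_ ?_ hint ?_
  · simp only [Complex.ofReal_zero, Complex.zero_cpow hb1, mul_zero, zero_mul, sub_zero] at key
    have h2 := integral_add ((hi.const_mul (b + 1 + z)).sub (hi1.const_mul z))
      ((hi.sub hi2).const_mul q)
    have h3 := integral_sub (hi.const_mul (b + 1 + z)) (hi1.const_mul z)
    have h4 := integral_sub hi hi2
    simp only [Pi.sub_apply, Pi.add_apply] at key h2 h3 h4
    rw [h2, h3, integral_const_mul, integral_const_mul, integral_const_mul, h4] at key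
    unfold eulerKernelIntegral
    linear_combination key
  · refine ContinuousAt.continuousWithinAt ?_
    refine ContinuousAt.mul (ContinuousAt.mul (by fun_prop) ?_) ?_
    · exact Complex.continuousAt_ofReal_cpow_const _ _ (Or.inl (by simp; linarith))
    · exact ContinuousAt.cpow (by fun_prop) continuousAt_const (by simp)
  · intro s hs
    have hs : (0 : ℝ) < s := hs
    have hs0 : (s : ℂ) ≠ 0 := by exact_mod_cast hs.ne'
    have hsl1 := one_add_div_mem_slitPlane hsl hs.le
    have hd : HasDerivAt (fun s : ℂ => Complex.exp (-s) * s ^ (b + 1) * (1 + s / z) ^ q)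
        _ (s : ℂ) :=
      (((hasDerivAt_neg (s : ℂ)).cexp).mul
        ((hasDerivAt_id (s : ℂ)).cpow_const (c := b + 1) (by simp [hs]))).mul
        ((((hasDerivAt_id (s : ℂ)).div_const z).const_add 1).cpow_const (c := q) hsl1)
    refine hd.comp_ofReal.congr_deriv ?_
    have h1 := Complex.slitPlane_ne_zero hsl1
    have h2 : (1 + (s : ℂ) / z) ^ q = (1 + (s : ℂ) / z) ^ (q - 1) * (1 + (s : ℂ) / z) := by
      rw [← cpow_add_one_of_ne_zero _ h1, sub_add_cancel]
    simp only [Pi.sub_apply, Pi.add_apply, Pi.mul_apply, id, cpow_add_one_of_ne_zero _ h1,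
      cpow_add_one_of_ne_zero _ hs0, add_sub_cancel_right]
    rw [h2]
    field_simp
    ring
  · obtain ⟨K, hK, h⟩ := exists_norm_one_add_div_cpow_le hzn q
    have h0 : Tendsto (fun s : ℝ => K * (Real.exp (-(s / 2)) * s ^ (b + 1).re)) atTop (𝓝 0) := by
      have := (tendsto_rpow_mul_exp_neg_mul_atTop_nhds_zero (b + 1).re (1 / 2)
        (by norm_num)).const_mul K
      rw [mul_zero] at this
      refine this.congr fun s => ?_
      rw [mul_comm (Real.exp _)]
      congr 3
      ring
    refine squeeze_zero_norm' ?_ h0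
    filter_upwards [eventually_gt_atTop 0] with s hs
    exact norm_exp_neg_mul_cpow_mul_le hs
      (h z s le_rfl hs.le (le_trans (by norm_num) (one_le_norm_one_add_div hz hs.le)))

/-! ### Energy argument -/

open Filter Topology ComplexConjugate in
/-- Energy argument along horizontal rays for the first order system `z A' = G`,
`z G' = z G + (μ + z κ) A` with `0 ≤ μ` and `0 < Re κ`: a bounded solution in the right half
plane satisfies `Re (conj A * G) ≤ 0`, and a zero of `A` propagates along the ray. -/
theorem re_conj_mul_nonpos_of_system {A G : ℂ → ℂ} {κ : ℂ} {μ : ℝ} (hκ : 0 < κ.re) (hμ : 0 ≤ μ)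
    (hA : ∀ z : ℂ, 0 ≤ z.re → z ≠ 0 → HasDerivAt A (G z / z) z)
    (hG : ∀ z : ℂ, 0 ≤ z.re → z ≠ 0 → HasDerivAt G (G z + (μ / z + κ) * A z) z)
    {z : ℂ} (hz : 0 ≤ z.re) (hz0 : z ≠ 0) {C : ℝ}
    (hC : ∀ t : ℝ, 0 ≤ t → ‖A (z + t)‖ ≤ C ∧ ‖G (z + t)‖ ≤ C) :
    (conj (A z) * G z).re ≤ 0 ∧ (A z = 0 → ∀ t : ℝ, 0 < t → A (z + t) = 0) := by
  -- The weight `e^{-t}` cancels the term `G` in `G'`.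
  set H : ℝ → ℝ := fun t => Real.exp (-t) * (conj (A (z + t)) * G (z + t)).re with hH
  have hre : ∀ t : ℝ, 0 ≤ t → 0 ≤ (z + t).re := fun t ht => by simp; positivity
  have hne : ∀ t : ℝ, 0 ≤ t → z + t ≠ 0 := fun t ht h => by
    have h1 := congrArg Complex.re h
    have h2 := congrArg Complex.im h
    simp at h1 h2
    exact hz0 (Complex.ext (by simp; linarith) (by simp [h2]))
  set D : ℝ → ℝ := fun t => Real.exp (-t) *
    (Complex.normSq (G (z + t)) * ((z + t)⁻¹).re +
      (μ * ((z + t)⁻¹).re + κ.re) * Complex.normSq (A (z + t))) with hD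
  have hinv : ∀ t : ℝ, 0 ≤ t → 0 ≤ ((z + t)⁻¹).re := fun t ht => by
    rw [Complex.inv_re]
    exact div_nonneg (hre t ht) (Complex.normSq_nonneg _)
  have hDnn : ∀ t : ℝ, 0 ≤ t → 0 ≤ D t := fun t ht => by
    have h1 := hinv t ht
    have h2 := Complex.normSq_nonneg (G (z + t))
    have h3 := Complex.normSq_nonneg (A (z + t))
    simp only [hD]
    positivity
  have hHD : ∀ t : ℝ, 0 ≤ t → HasDerivAt H (D t) t := fun t ht => by
    have h0 : HasDerivAt (fun t : ℝ => z + (t : ℂ)) 1 t :=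
      (Complex.ofRealCLM.hasDerivAt (x := t)).const_add z
    have hA' := (hA _ (hre t ht) (hne t ht)).comp t h0
    have hG' := (hG _ (hre t ht) (hne t ht)).comp t h0
    have hP := Complex.reCLM.hasFDerivAt.comp_hasDerivAt t (hA'.star.mul hG')
    have hE := (Real.hasDerivAt_exp (-t)).comp t (hasDerivAt_neg t)
    refine (hE.mul hP).congr_deriv ?_
    have hw := hne t ht
    simp only [hD, Function.comp_apply, Complex.reCLM_apply, Pi.mul_apply]
    generalize z + (t : ℂ) = w at hw ⊢
    simp only [Complex.star_def, div_eq_mul_inv]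
    generalize w⁻¹ = v
    simp only [Complex.add_re, Complex.mul_re, Complex.conj_re, Complex.conj_im, Complex.mul_im,
      Complex.add_im, Complex.ofReal_re, Complex.ofReal_im, Complex.normSq_apply,
      Complex.one_re, Complex.one_im]
    ring
  have hmono : MonotoneOn H (Set.Ici 0) := by
    refine monotoneOn_of_hasDerivWithinAt_nonneg (f' := D) (convex_Ici 0)
      (fun t ht => (hHD t ht).continuousAt.continuousWithinAt) (fun t ht => ?_) (fun t ht => ?_)
    · rw [interior_Ici] at ht
      exact (hHD t (le_of_lt ht)).hasDerivWithinAt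
    · rw [interior_Ici] at ht
      exact hDnn t (le_of_lt ht)
  have hlim : Tendsto H atTop (𝓝 0) := by
    have h0 : Tendsto (fun t : ℝ => Real.exp (-t) * (C * C)) atTop (𝓝 0) := by
      simpa using (Real.tendsto_exp_neg_atTop_nhds_zero).mul_const (C * C)
    refine squeeze_zero_norm' ?_ h0
    filter_upwards [eventually_ge_atTop 0] with t ht
    obtain ⟨h1, h2⟩ := hC t ht
    simp only [hH]
    rw [norm_mul, Real.norm_of_nonneg (Real.exp_pos _).le, Real.norm_eq_abs]
    gcongr
    refine (Complex.abs_re_le_norm _).trans ?_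
    rw [norm_mul, Complex.norm_conj]
    gcongr
    exact (norm_nonneg _).trans h1
  have hle : ∀ t : ℝ, 0 ≤ t → H t ≤ 0 := fun t ht => by
    refine ge_of_tendsto hlim ?_
    filter_upwards [eventually_ge_atTop t] with u hu
    exact hmono ht (ht.trans hu) hu
  refine ⟨by simpa [hH] using hle 0 le_rfl, fun hz1 t ht => ?_⟩
  -- `H` starts at 0, increases and stays nonpositive, so it vanishes identically, and so does its
  -- derivative `D`; then `Re κ > 0` forces `A = 0`.
  have hzero : ∀ u : ℝ, 0 ≤ u → H u = 0 := fun u hu => by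
    refine le_antisymm (hle u hu) ?_
    have := hmono (Set.mem_Ici.2 le_rfl) hu hu
    simpa [hH, hz1] using this
  have hDt : D t = 0 := by
    refine (hHD t ht.le).unique ((hasDerivAt_const t (0 : ℝ)).congr_of_eventuallyEq ?_)
    filter_upwards [lt_mem_nhds ht] with u hu
    exact hzero u hu.le
  have h1 := hinv t ht.le
  have h2 := Complex.normSq_nonneg (G (z + t))
  have h3 := Complex.normSq_nonneg (A (z + t))
  rw [← Complex.normSq_eq_zero]
  have h4 : Complex.normSq (G (z + t)) * ((z + t)⁻¹).re +
      (μ * ((z + t)⁻¹).re + κ.re) * Complex.normSq (A (z + t)) = 0 := by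
    simpa [hD, (Real.exp_pos _).ne'] using hDt
  have h5 : 0 ≤ μ * ((z + t)⁻¹).re := by positivity
  nlinarith [mul_nonneg h2 h1, mul_nonneg h5 h3]

/-! ### The first order system for the stripped Whittaker function -/

/-- `z^{-κ} ∫_0^∞ e^{-s} s^{m+κ-1} (1 + s/z)^q ds`. -/
noncomputable def tricomiIntegral (m : ℝ) (κ q z : ℂ) : ℂ :=
  z ^ (-κ) * eulerKernelIntegral (m + κ - 1) q z

theorem hasDerivAt_tricomiIntegral {m : ℝ} {κ : ℂ} (hmκ : 0 < m + κ.re) (q : ℂ) {z : ℂ}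
    (hz : 0 ≤ z.re) (hz0 : z ≠ 0) :
    HasDerivAt (tricomiIntegral m κ q)
      ((-(κ + q) * tricomiIntegral m κ q z + q * tricomiIntegral m κ (q - 1) z) / z) z := by
  have hb : -1 < ((m : ℂ) + κ - 1).re := by simp; linarith
  have h1 := (hasDerivAt_id z).cpow_const (c := -κ) (mem_slitPlane_of_re_nonneg hz hz0)
  refine (h1.mul (hasDerivAt_eulerKernelIntegral hb q hz hz0)).congr_deriv ?_
  have h2 : z ^ (-κ) = z ^ (-κ - 1) * z := by
    rw [← cpow_add_one_of_ne_zero _ hz0, sub_add_cancel]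
  simp only [id, tricomiIntegral]
  rw [h2]
  field_simp
  ring

theorem tricomiIntegral_contiguous {m : ℝ} {κ : ℂ} (hmκ : 0 < m + κ.re) (q : ℂ) {z : ℂ}
    (hz : 0 ≤ z.re) (hz0 : z ≠ 0) :
    (m + κ + z) * tricomiIntegral m κ q z - z * tricomiIntegral m κ (q + 1) z =
      -q * (tricomiIntegral m κ q z - tricomiIntegral m κ (q - 1) z) := by
  have hb : -1 < ((m : ℂ) + κ - 1).re := by simp; linarith
  have h := eulerKernelIntegral_integration_by_parts hb q hz hz0
  simp only [tricomiIntegral]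
  linear_combination z ^ (-κ) * h

/-- Here `Re κ > 0` keeps `z^{-κ}` bounded away from the origin. -/
theorem exists_norm_tricomiIntegral_le {m : ℝ} {κ : ℂ} (hκ : 0 < κ.re) (hmκ : 0 < m + κ.re)
    (q : ℂ) {δ : ℝ} (hδ : 0 < δ) :
    ∃ C : ℝ, ∀ z : ℂ, 0 ≤ z.re → δ ≤ ‖z‖ → ‖tricomiIntegral m κ q z‖ ≤ C := by
  have hb : -1 < ((m : ℂ) + κ - 1).re := by simp; linarith
  obtain ⟨C, hC⟩ := exists_norm_eulerKernelIntegral_le hb q hδ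
  refine ⟨(δ ^ (-κ.re) * Real.exp (Real.pi * |κ.im|)) * C, fun z hz hzδ => ?_⟩
  rw [tricomiIntegral, norm_mul]
  have h1 := Complex.norm_cpow_le z (-κ)
  have h2 : ‖z‖ ^ (-κ).re ≤ δ ^ (-κ.re) := by
    rw [Complex.neg_re]
    exact Real.rpow_le_rpow_of_nonpos hδ hzδ (by linarith)
  have h3 : (Real.exp (Complex.arg z * (-κ).im))⁻¹ ≤ Real.exp (Real.pi * |κ.im|) := by
    rw [← Real.exp_neg]
    apply Real.exp_le_exp.2
    calc -(Complex.arg z * (-κ).im) = Complex.arg z * κ.im := by simp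
      _ ≤ |Complex.arg z * κ.im| := le_abs_self _
      _ = |Complex.arg z| * |κ.im| := abs_mul _ _
      _ ≤ _ := by gcongr; exact Complex.abs_arg_le_pi _
  gcongr
  · rw [div_eq_mul_inv] at h1
    exact h1.trans (by gcongr)
  · exact hC z hz hzδ

/-- `z A'(z)` for `A = tricomiIntegral m κ (m - κ)`. -/
noncomputable def tricomiEulerDeriv (m : ℝ) (κ z : ℂ) : ℂ :=
  -m * tricomiIntegral m κ (m - κ) z + (m - κ) * tricomiIntegral m κ (m - κ - 1) z

theorem hasDerivAt_tricomiIntegral_self {m : ℝ} {κ : ℂ} (hmκ : 0 < m + κ.re) {z : ℂ}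
    (hz : 0 ≤ z.re) (hz0 : z ≠ 0) :
    HasDerivAt (tricomiIntegral m κ (m - κ)) (tricomiEulerDeriv m κ z / z) z := by
  refine (hasDerivAt_tricomiIntegral hmκ _ hz hz0).congr_deriv ?_
  rw [tricomiEulerDeriv, add_sub_cancel]

theorem hasDerivAt_tricomiEulerDeriv {m : ℝ} {κ : ℂ} (hmκ : 0 < m + κ.re) {z : ℂ}
    (hz : 0 ≤ z.re) (hz0 : z ≠ 0) :
    HasDerivAt (tricomiEulerDeriv m κ)
      (tricomiEulerDeriv m κ z + (((m ^ 2 : ℝ) : ℂ) / z + κ) * tricomiIntegral m κ (m - κ) z)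
      z := by
  refine (((hasDerivAt_tricomiIntegral hmκ (m - κ) hz hz0).const_mul (-(m : ℂ))).add
    ((hasDerivAt_tricomiIntegral hmκ (m - κ - 1) hz hz0).const_mul ((m : ℂ) - κ))).congr_deriv ?_
  -- Eliminates the integral with exponent `m - κ - 2`.
  have h := tricomiIntegral_contiguous hmκ (m - κ - 1) hz hz0
  rw [sub_add_cancel] at h
  simp only [tricomiEulerDeriv]
  push_cast
  field_simp
  linear_combination -((m : ℂ) - κ) * h

open Filter Topology ComplexConjugate in
theorem tricomiIntegral_ne_zero_and_re_nonpos {m : ℝ} {κ : ℂ} (hκ : 0 < κ.re)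
    (hmκ : 0 < m + κ.re) {z : ℂ} (hz : 0 ≤ z.re) (hz0 : z ≠ 0) :
    tricomiIntegral m κ (m - κ) z ≠ 0 ∧
      (conj (tricomiIntegral m κ (m - κ) z) * tricomiEulerDeriv m κ z).re ≤ 0 := by
  obtain ⟨C₁, h₁⟩ := exists_norm_tricomiIntegral_le hκ hmκ (m - κ) (norm_pos_iff.2 hz0)
  obtain ⟨C₂, h₂⟩ := exists_norm_tricomiIntegral_le hκ hmκ (m - κ - 1) (norm_pos_iff.2 hz0)
  obtain ⟨hle, hzero⟩ := re_conj_mul_nonpos_of_system hκ (sq_nonneg m)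
    (fun z hz hz0 => hasDerivAt_tricomiIntegral_self hmκ hz hz0)
    (fun z hz hz0 => hasDerivAt_tricomiEulerDeriv hmκ hz hz0) hz hz0
    (C := max C₁ (‖(-m : ℂ)‖ * C₁ + ‖(m : ℂ) - κ‖ * C₂)) (fun t ht => by
      have hre : 0 ≤ (z + t).re := by simp; positivity
      have hn := norm_le_norm_add_ofReal hz ht
      refine ⟨(h₁ _ hre hn).trans (le_max_left _ _), le_trans ?_ (le_max_right _ _)⟩
      refine (norm_add_le _ _).trans ?_
      rw [norm_mul, norm_mul]
      gcongr
      · exact h₁ _ hre hn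
      · exact h₂ _ hre hn)
  refine ⟨fun h0 => ?_, hle⟩
  have hb : -1 < ((m : ℂ) + κ - 1).re := by simp; linarith
  have hlim := tendsto_eulerKernelIntegral hb (m - κ) hz hz0
  have hlim0 : Tendsto (fun t : ℝ => eulerKernelIntegral (m + κ - 1) (m - κ) (z + t)) atTop
      (𝓝 0) := by
    refine tendsto_const_nhds.congr' ?_
    filter_upwards [eventually_gt_atTop 0] with t ht
    have hne : z + t ≠ 0 :=
      norm_pos_iff.1 ((norm_pos_iff.2 hz0).trans_le (norm_le_norm_add_ofReal hz ht.le))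
    have := hzero h0 t ht
    rw [tricomiIntegral, mul_eq_zero, Complex.cpow_eq_zero_iff] at this
    tauto
  refine Complex.Gamma_ne_zero_of_re_pos (s := (m : ℂ) + κ - 1 + 1) (by simpa using hmκ) ?_
  exact tendsto_nhds_unique hlim hlim0

open ComplexConjugate in
theorem norm_tricomiIntegral_mul_le {m : ℝ} {κ : ℂ} (hκ : 0 < κ.re) (hmκ : 0 < m + κ.re)
    {z : ℂ} (hz : 0 ≤ z.re) (hz0 : z ≠ 0) {τ : ℝ} (hτ : 1 ≤ τ) :
    ‖tricomiIntegral m κ (m - κ) (τ * z)‖ ≤ ‖tricomiIntegral m κ (m - κ) z‖ := by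
  set A := tricomiIntegral m κ (m - κ) with hA
  have hre : ∀ t : ℝ, 0 < t → 0 ≤ ((t : ℂ) * z).re := fun t ht => by simp; positivity
  have hne : ∀ t : ℝ, 0 < t → (t : ℂ) * z ≠ 0 := fun t ht =>
    mul_ne_zero (by exact_mod_cast ht.ne') hz0
  have hd : ∀ t : ℝ, 0 < t → HasDerivAt (fun t : ℝ => ‖A (t * z)‖ ^ 2)
      (2 / t * (conj (A (t * z)) * tricomiEulerDeriv m κ (t * z)).re) t := fun t ht => by
    have h0 : HasDerivAt (fun t : ℝ => (t : ℂ) * z) z t := by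
      simpa using (Complex.ofRealCLM.hasDerivAt (x := t)).mul_const z
    have h1 := ((hasDerivAt_tricomiIntegral_self hmκ (hre t ht) (hne t ht)).comp t h0).norm_sq
    refine h1.congr_deriv ?_
    have ht0 : (t : ℂ) ≠ 0 := by exact_mod_cast ht.ne'
    have h2 : tricomiEulerDeriv m κ (t * z) / (t * z) * z =
        ((t⁻¹ : ℝ) : ℂ) * tricomiEulerDeriv m κ (t * z) := by
      push_cast
      field_simp
    rw [h2, Complex.inner]
    simp only [Complex.mul_re, Complex.mul_im, Complex.conj_re, Complex.conj_im,
      Complex.ofReal_re, Complex.ofReal_im, Function.comp_apply, hA]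
    ring
  have hanti : AntitoneOn (fun t : ℝ => ‖A (t * z)‖ ^ 2) (Set.Ioi 0) := by
    refine antitoneOn_of_hasDerivWithinAt_nonpos (convex_Ioi 0)
      (fun t ht => (hd t ht).continuousAt.continuousWithinAt)
      (fun t ht => (hd t (interior_subset ht)).hasDerivWithinAt) (fun t ht => ?_)
    have ht : (0 : ℝ) < t := interior_subset ht
    exact mul_nonpos_of_nonneg_of_nonpos (by positivity)
      (tricomiIntegral_ne_zero_and_re_nonpos hκ hmκ (hre t ht) (hne t ht)).2
  have := hanti (Set.mem_Ioi.2 one_pos) (Set.mem_Ioi.2 (one_pos.trans_le hτ)) hτ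
  simp only [Complex.ofReal_one, one_mul] at this
  exact (sq_le_sq₀ (norm_nonneg _) (norm_nonneg _)).1 this

/-! ### Return to the Whittaker function -/

theorem whittakerIntegral_eq_tricomiIntegral (m : ℝ) (k : ℂ) {z : ℂ} (hz0 : z ≠ 0) :
    whittakerIntegral k m z = Complex.exp (-z / 2) * z ^ (1 / 2 : ℂ) /
      Complex.Gamma (1 / 2 + m - k) *
        tricomiIntegral m (1 / 2 - k) (m - (1 / 2 - k)) z := by
  have h1 : (m : ℂ) + (1 / 2 - k) - 1 = m - k - 1 / 2 := by ring
  have h2 : (m : ℂ) - (1 / 2 - k) = m + k - 1 / 2 := by ring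
  have h3 : z ^ k = z ^ (1 / 2 : ℂ) * z ^ (-(1 / 2 - k)) := by
    rw [← Complex.cpow_add _ _ hz0]
    congr 1
    ring
  rw [whittakerIntegral, tricomiIntegral, eulerKernelIntegral, h1, h2, h3]
  ring

theorem norm_cpow_half_sq (z : ℂ) : ‖z ^ (1 / 2 : ℂ)‖ ^ 2 = ‖z‖ := by
  rw [← norm_pow, ← Complex.cpow_nat_mul]
  simp

theorem norm_sq_whittakerIntegral (m : ℝ) (k : ℂ) {z : ℂ} (hz0 : z ≠ 0) :
    ‖whittakerIntegral k m z‖ ^ 2 = Real.exp (-z.re) * ‖z‖ /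
      ‖Complex.Gamma (1 / 2 + m - k)‖ ^ 2 *
        ‖tricomiIntegral m (1 / 2 - k) (m - (1 / 2 - k)) z‖ ^ 2 := by
  rw [whittakerIntegral_eq_tricomiIntegral m k hz0, norm_mul, norm_div, norm_mul, mul_pow, div_pow,
    mul_pow, norm_cpow_half_sq, Complex.norm_exp, ← Real.exp_nat_mul]
  congr 4
  simp
  ring

theorem whittakerIntegral_ne_zero_and_norm_sq_div_le {x : ℂ} (hx : 0 ≤ x.re) (hx0 : x ≠ 0)
    {τ : ℝ} (hτ : 1 ≤ τ) {m : ℝ} {k : ℂ} (hk : k.re < 1 / 2) (hmk : 0 < (1 / 2 + m - k).re) :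
    whittakerIntegral k m x ≠ 0 ∧
      ‖whittakerIntegral k m (τ * x) / whittakerIntegral k m x‖ ^ 2
        ≤ τ * Real.exp ((1 - τ) * x.re) := by
  have hκ : 0 < (1 / 2 - k).re := by simp; linarith
  have hmκ : 0 < m + (1 / 2 - k).re := by simp at hmk ⊢; linarith
  have hΓ := Complex.Gamma_ne_zero_of_re_pos hmk
  have hτ0 : 0 < τ := one_pos.trans_le hτ
  have hne : whittakerIntegral k m x ≠ 0 := by
    rw [whittakerIntegral_eq_tricomiIntegral m k hx0]
    have h := (tricomiIntegral_ne_zero_and_re_nonpos hκ hmκ hx hx0).1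
    have h2 : x ^ (1 / 2 : ℂ) ≠ 0 := by simp [Complex.cpow_eq_zero_iff, hx0]
    exact mul_ne_zero (div_ne_zero (mul_ne_zero (Complex.exp_ne_zero _) h2) hΓ) h
  refine ⟨hne, ?_⟩
  rw [norm_div, div_pow, div_le_iff₀ (by positivity), norm_sq_whittakerIntegral m k hx0,
    norm_sq_whittakerIntegral m k (mul_ne_zero (by exact_mod_cast hτ0.ne') hx0)]
  have h := norm_tricomiIntegral_mul_le hκ hmκ hx hx0 hτ
  have h1 : Real.exp (-((τ : ℂ) * x).re) = Real.exp ((1 - τ) * x.re) * Real.exp (-x.re) := by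
    rw [← Real.exp_add]
    congr 1
    simp
    ring
  rw [h1, norm_mul, Complex.norm_real, Real.norm_of_nonneg hτ0.le]
  calc _ ≤ Real.exp ((1 - τ) * x.re) * Real.exp (-x.re) * (τ * ‖x‖) /
      ‖Complex.Gamma (1 / 2 + m - k)‖ ^ 2 *
        ‖tricomiIntegral m (1 / 2 - k) (m - (1 / 2 - k)) x‖ ^ 2 := by gcongr
    _ = _ := by ring

theorem theorem3p1 (x : ℂ) (hx0 : x ≠ 0) (hx : |Complex.arg x| ≤ Real.pi / 2)
    (τ : ℝ) (hτ : 1 ≤ τ) (m : ℝ) (k : ℂ) (hk : k.re < 1 / 2) :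
    whittakerW k (m : ℂ) x ≠ 0 ∧
      ‖whittakerW k (m : ℂ) ((τ : ℂ) * x) / whittakerW k (m : ℂ) x‖ ^ 2
        ≤ τ * Real.exp ((1 - τ) * x.re) := by
  have hre : 0 ≤ x.re := Complex.abs_arg_le_pi_div_two_iff.1 hx
  unfold whittakerW
  split_ifs with h
  · exact whittakerIntegral_ne_zero_and_norm_sq_div_le hre hx0 hτ hk h
  -- In this branch `Re k < 1/2` forces `m < 0`, so `-m` satisfies the convergence condition.
  · rw [← Complex.ofReal_neg]
    refine whittakerIntegral_ne_zero_and_norm_sq_div_le hre hx0 hτ hk ?_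
    simp at h ⊢
    linarith
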